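/- **Setting.** Let $G$ be a semisimple real Lie group with a contact grading $\mathfrak g=\mathfrak g_{-2}\oplus\cdots\oplus\mathfrak g_2$ of its Lie algebra (so $\dim\mathfrak g_{-2}=1$, $\mathfrak g_{-1}\neq 0$, and the bracket $\mathfrak g_{-1}\times\mathfrak g_{-1}\to\mathfrak g_{-2}$ is non-degenerate). Put $\mathfrak g^i=\bigoplus_{j\ge i}\mathfrak g_j$, and let $P\subset G$ be a corresponding parabolic subgroup, i.e. a closed subgroup with Lie algebra $\mathfrak p=\mathfrak g^0$ whose adjoint action preserves all $\mathfrak g^i$. Let $G_0\subset P$ be the subgroup of elements whose adjoint action preserves the grading, and $P_+=\exp(\mathfrak g^1)$, so $P=G_0\ltimes P_+$. A *parabolic contact structure of type $(G,P)$* on a manifold $M^\#$ is a regular normal Cartan geometry $(p^\#:\mathcal G^\#\to M^\#,\omega)$ of type $(G,P)$. Its underlying $G_0$-bundle is $\mathcal G_0^\#=\mathcal G^\#/P_+$, its contact subbundle is the image of $\omega^{-1}(\mathfrak g^{-1})$ in $TM^\#$, and $\theta^\#_{-1}$ denotes the partially defined $\mathfrak g_{-1}$-valued form on $\mathcal G_0^\#$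 induced by the $\mathfrak g_{-1}$-component of $\omega$ on $\omega^{-1}(\mathfrak g^{-1})$. A *PCS-structure of type $(G,P)$* on $M$ is a principal $G_0$-bundle $p:\mathcal G_0\to M$ with a smooth $G_0$-equivariant form $\theta\in\Omega^1(\mathcal G_0,\mathfrak g_{-1})$ that is onto $\mathfrak g_{-1}$ at each point and has the vertical bundle as its kernel, such that the line of two-forms on $M$ corresponding to the bracket $\mathfrak g_{-1}\times\mathfrak g_{-1}\to\mathfrak g_{-2}$ is locally spanned by closed forms. (For $\mathfrak g$ of type $C_n$, where the structure on $M$ is a conformally Fedosov structure, the additional class of connections plays no role here.) An *infinitesimal automorphism* of $M^\#$ is a vector field $\xi\in\mathfrak X(M^\#)$ whose local flows are automorphisms, i.e. $\xi$ has a $P$-invariant lift to $\mathcal G^\#$ whose local flows are principal bundle maps preserving $\omega$; let $\xi_0$ be the induced vector field on $\mathcal G_0^\#$. It is *transversal* if it is nowhere tangent to the contact subbundle. A *PCS-quotient by $\xi$* consists of a PCS-structure on $M$, a surjective submersion $q:M^\#\to M$ with connected fibers whose tangent spaces are spanned by $\xi$, and a morphism $q_0:\mathcal G_0^\#\to\mathcal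 G_0$ of principal $G_0$-bundles over $q$ that is a surjective submersion with connected fibers whose tangent spaces are spanned by $\xi_0$, and such that $q_0^*\theta$ coincides with $\theta^\#_{-1}$. For a finite dimensional representation $\mathbb W$ of $G_0$ (viewed as a representation of $P$ with trivial action of $P_+$) put $\mathcal WM^\#=\mathcal G^\#\times_P\mathbb W\cong\mathcal G_0^\#\times_{G_0}\mathbb W$ and $\mathcal WM=\mathcal G_0\times_{G_0}\mathbb W$. Identifying sections with equivariant functions, composition with $q_0$ defines $q_0^*:\Gamma(\mathcal WM)\to\Gamma(\mathcal WM^\#)$. An *invariant linear differential operator* between the bundles induced by $\mathbb W$ and $\tilde{\mathbb W}$ is a family of linear differential operators $D^\#:\Gamma(\mathcal WM^\#)\to\Gamma(\tilde{\mathcal W}M^\#)$, one for each manifold with a parabolic contact structure of type $(G,P)$, compatible with isomorphisms and with restriction to open subsets. **Theorem.** Let $q:M^\#\to M$ be a PCS-quotient by a transversal infinitesimal automorphism $\xi$ of a parabolic contact structure of type $(G,P)$, with bundle map $q_0:\mathcal G_0^\#\to\mathcal G_0$, let $\mathbb W$ and $\tilde{\mathbb W}$ be finite dimensional representations of $G_0$,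 and let $D^\#:\Gamma(\mathcal WM^\#)\to\Gamma(\tilde{\mathcal W}M^\#)$ be (the value on $M^\#$ of) an invariant linear differential operator. Then there is a unique linear differential operator $D:\Gamma(\mathcal WM)\to\Gamma(\tilde{\mathcal W}M)$ such that $q_0^*\circ D=D^\#\circ q_0^*$. -/

import Mathlib

open scoped Manifold ContDiff

universe u v w w'

namespace PCS

/-! ### Smooth manifolds, Lie groups, representations -/

/-- A finite dimensional smooth manifold (Hausdorff, second countable, without boundary). -/
structure SmoothManifold where
  carrier : Type u
  dim : ℕ
  [topology : TopologicalSpace carrier]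
  [charts : ChartedSpace (EuclideanSpace ℝ (Fin dim)) carrier]
  [smooth : IsManifold (𝓡 dim) ∞ carrier]
  [t2 : T2Space carrier]
  [secondCountable : SecondCountableTopology carrier]

instance : CoeSort SmoothManifold.{u} (Type u) := ⟨fun M => M.carrier⟩

attribute [instance] SmoothManifold.topology SmoothManifold.charts SmoothManifold.smooth
  SmoothManifold.t2 SmoothManifold.secondCountable

/-- The model with corners of a smooth manifold. -/
noncomputable abbrev SmoothManifold.I (M : SmoothManifold.{u}) := 𝓡 M.dim

/-- The tangent space at a point. -/
abbrev SmoothManifold.T (M : SmoothManifold.{u}) (x : M) := TangentSpace M.I x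

/-- A (finite dimensional, real) Lie group. -/
structure SmoothLieGroup extends SmoothManifold.{v} where
  [group : Group carrier]
  [lieGroup : LieGroup (𝓡 dim) ∞ carrier]

instance : CoeSort SmoothLieGroup.{v} (Type v) := ⟨fun G => G.toSmoothManifold.carrier⟩

attribute [instance] SmoothLieGroup.group SmoothLieGroup.lieGroup

instance (G : SmoothLieGroup.{v}) : LieGroup (𝓡 G.dim) (minSmoothness ℝ 3) G :=
  LieGroup.of_le (n := ∞) (by
    rw [minSmoothness_of_isRCLikeNormedField]
    exact WithTop.coe_le_coe.2 le_top)

/-- The Lie algebra of a Lie group: the tangent space at `1` with the bracket of left invariant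
vector fields. -/
abbrev SmoothLieGroup.lie (G : SmoothLieGroup.{v}) : Type := GroupLieAlgebra (𝓡 G.dim) G

/-- The adjoint action of a Lie group on its Lie algebra. -/
noncomputable def SmoothLieGroup.Ad (G : SmoothLieGroup.{v}) (g : G) : G.lie →L[ℝ] G.lie :=
  mfderiv G.I G.I (fun x : G => g * x * g⁻¹) 1

/-- The derivative at `1` of a homomorphism of Lie groups. -/
noncomputable def lieMap {H G : SmoothLieGroup.{v}} (φ : H →* G) : H.lie →L[ℝ] G.lie :=
  mfderiv H.I G.I (fun x : H => φ x) 1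

/-- `φ : H → G` identifies the Lie group `H` with a closed Lie subgroup of `G`. -/
structure IsClosedLieSubgroup {H G : SmoothLieGroup.{v}} (φ : H →* G) : Prop where
  contMDiff : ContMDiff H.I G.I ∞ (fun x : H => φ x)
  isClosedEmbedding : Topology.IsClosedEmbedding (fun x : H => φ x)
  injective_lieMap : Function.Injective (lieMap φ)

/-- `h = exp a`: there is a one-parameter subgroup with initial velocity `a` that is `h` at
time `1`. -/
def SmoothLieGroup.IsExp (H : SmoothLieGroup.{v}) (a : H.lie) (h : H) : Prop :=
  ∃ γ : ℝ → H, ContMDiff 𝓘(ℝ, ℝ) H.I ∞ γ ∧ (∀ s t, γ (s + t) = γ s * γ t) ∧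
    (mfderiv 𝓘(ℝ, ℝ) H.I γ 0 (1 : ℝ) : EuclideanSpace ℝ (Fin H.dim)) = a ∧ γ 1 = h

/-- A smooth representation of a Lie group on a normed space. -/
structure SmoothRep (H : SmoothLieGroup.{v}) (W : Type w)
    [NormedAddCommGroup W] [NormedSpace ℝ W] where
  toHom : H →* (W →L[ℝ] W)
  contMDiff : ContMDiff H.I 𝓘(ℝ, W →L[ℝ] W) ∞ (fun h : H => toHom h)

/-! ### Contact gradings and the type `(G, P)` -/

/-- A contact grading `𝔤 = 𝔤₋₂ ⊕ 𝔤₋₁ ⊕ 𝔤₀ ⊕ 𝔤₁ ⊕ 𝔤₂` of a Lie algebra: `𝔤₋₂` is a line, `𝔤₋₁` is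
nonzero and the bracket `𝔤₋₁ × 𝔤₋₁ → 𝔤₋₂` is non-degenerate, so that `𝔤₋₂ ⊕ 𝔤₋₁` is a Heisenberg
algebra. -/
structure ContactGrading (𝔤 : Type w) [LieRing 𝔤] [LieAlgebra ℝ 𝔤] where
  gr : ℤ → Submodule ℝ 𝔤
  isInternal : DirectSum.IsInternal gr
  gr_eq_bot : ∀ i : ℤ, 2 < |i| → gr i = ⊥
  lie_mem : ∀ (i j : ℤ) (A B : 𝔤), A ∈ gr i → B ∈ gr j → ⁅A, B⁆ ∈ gr (i + j)
  finrank_gr_neg_two : Module.finrank ℝ (gr (-2)) = 1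
  gr_neg_one_ne_bot : gr (-1) ≠ ⊥
  nondegenerate : ∀ A ∈ gr (-1), (∀ B ∈ gr (-1), ⁅A, B⁆ = 0) → A = 0

/-- The filtration component `𝔤ⁱ = 𝔤ᵢ ⊕ 𝔤ᵢ₊₁ ⊕ ⋯`. In particular `𝔤⁰ = 𝔭` and `𝔤¹ = 𝔭₊`. -/
def ContactGrading.fil {𝔤 : Type w} [LieRing 𝔤] [LieAlgebra ℝ 𝔤] (gr : ContactGrading 𝔤)
    (i : ℤ) : Submodule ℝ 𝔤 :=
  ⨆ (j : ℤ) (_ : i ≤ j), gr.gr j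

/-- The negative part `𝔤₋ = 𝔤₋₂ ⊕ 𝔤₋₁`. -/
def ContactGrading.neg {𝔤 : Type w} [LieRing 𝔤] [LieAlgebra ℝ 𝔤] (gr : ContactGrading 𝔤) :
    Submodule ℝ 𝔤 :=
  gr.gr (-2) ⊔ gr.gr (-1)

/-- The algebraic data of a type `(G, P)` of parabolic contact structures: a semisimple Lie group
`G` with a contact grading of its Lie algebra, a parabolic subgroup `P` for this grading (a closed
subgroup with Lie algebra `𝔭` that preserves the filtration), and the subgroup `G₀ ⊆ P` of those
elements whose adjoint action preserves the grading. The subgroups are given as Lie groups with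
their inclusions `ι : P → G` and `ι₀ : G₀ → P`. -/
structure ContactType where
  G : SmoothLieGroup.{v}
  P : SmoothLieGroup.{v}
  G₀ : SmoothLieGroup.{v}
  semisimple : LieAlgebra.IsSemisimple ℝ G.lie
  grading : ContactGrading G.lie
  ι : P →* G
  isClosedLieSubgroup_ι : IsClosedLieSubgroup ι
  range_lieMap_ι : ∀ A : G.lie, (∃ a : P.lie, lieMap ι a = A) ↔ A ∈ grading.fil 0
  Ad_mem_fil : ∀ (p : P) (i : ℤ), ∀ A ∈ grading.fil i, G.Ad (ι p) A ∈ grading.fil i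
  ι₀ : G₀ →* P
  isClosedLieSubgroup_ι₀ : IsClosedLieSubgroup ι₀
  range_ι₀ : ∀ p : P, (∃ g : G₀, ι₀ g = p) ↔
    ∀ i : ℤ, ∀ A ∈ grading.gr i, G.Ad (ι p) A ∈ grading.gr i

/-- The subgroup `P₊ = exp(𝔭₊)` of `P` (as a set). -/
def ContactType.Pplus (T : ContactType.{v}) : Set T.P :=
  {p | ∃ a : T.P.lie, lieMap T.ι a ∈ T.grading.fil 1 ∧ T.P.IsExp a p}

/-! ### Principal bundles and their associated vector bundles -/

/-- A smooth principal bundle over `M` with structure group `H` (acting from the right). Locally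
over `U`, `(y, h) ↦ s y · h` is a diffeomorphism `U × H → proj⁻¹ U` with inverse
`u ↦ (proj u, τ u)`. -/
structure PrincipalBundle (H : SmoothLieGroup.{v}) (M : SmoothManifold.{u}) where
  total : SmoothManifold.{u}
  proj : total → M
  act : total → H → total
  contMDiff_proj : ContMDiff total.I M.I ∞ proj
  contMDiff_act : ContMDiff (total.I.prod H.I) total.I ∞ (fun z : total × H => act z.1 z.2)
  act_one : ∀ u, act u 1 = u
  act_mul : ∀ u g h, act u (g * h) = act (act u g) h
  proj_act : ∀ u g, proj (act u g) = proj u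
  locally_trivial : ∀ x : M, ∃ (U : Set M) (s : M → total) (τ : total → H),
    IsOpen U ∧ x ∈ U ∧ ContMDiffOn M.I total.I ∞ s U ∧
    ContMDiffOn total.I H.I ∞ τ (proj ⁻¹' U) ∧
    (∀ y ∈ U, proj (s y) = y) ∧
    (∀ y ∈ U, ∀ h, τ (act (s y) h) = h) ∧
    (∀ u ∈ proj ⁻¹' U, act (s (proj u)) (τ u) = u)

/-- The sections of the associated bundle `B ×_H W`, as the space of `H`-equivariant smooth
functions on the total space. -/
def PrincipalBundle.sections {H : SmoothLieGroup.{v}} {M : SmoothManifold.{u}}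
    (B : PrincipalBundle H M) {W : Type w} [NormedAddCommGroup W] [NormedSpace ℝ W]
    (ρ : SmoothRep H W) : Submodule ℝ (B.total → W) where
  carrier := {f | ContMDiff B.total.I 𝓘(ℝ, W) ∞ f ∧
    ∀ u (g : H), f (B.act u g) = ρ.toHom g⁻¹ (f u)}
  zero_mem' := ⟨contMDiff_const, fun _ _ => by simp⟩
  add_mem' := fun {f f'} hf hf' => ⟨hf.1.add hf'.1, fun u g => by simp [hf.2 u g, hf'.2 u g]⟩
  smul_mem' := fun c f hf => ⟨(c • ContinuousLinearMap.id ℝ W).contMDiff.comp hf.1,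
    fun u g => by simp [hf.2 u g]⟩

/-- A linear map between spaces of sections of vector bundles (given as spaces of equivariant
functions on a principal bundle with total space `N`) is a linear differential operator if for
some `r` the value of `D f` at a point depends only on the `r`-jet of `f` there. The `r`-jet of a
section at `x` vanishes iff the `r`-jet of the corresponding equivariant function vanishes at
some (equivalently, any) point `u` over `x`. -/
def IsLinearDiffOp {N : SmoothManifold.{u}} {W : Type w} [NormedAddCommGroup W] [NormedSpace ℝ W]
    {W' : Type w'} [NormedAddCommGroup W'] [NormedSpace ℝ W'] {S : Submodule ℝ (N → W)}
    {S' : Submodule ℝ (N → W')} (D : S →ₗ[ℝ] S') : Prop :=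
  ∃ r : ℕ, ∀ (f : S) (u : N),
    (∀ j ≤ r, iteratedFDeriv ℝ j ((f : N → W) ∘ (extChartAt N.I u).symm) (extChartAt N.I u u) = 0) →
      (D f : N → W') u = 0

/-! ### Parabolic contact structures -/

/-- A Cartan geometry of type `(G, P)`: a principal `P`-bundle with a Cartan connection. -/
structure CartanGeometry (T : ContactType.{v}) where
  base : SmoothManifold.{u}
  bundle : PrincipalBundle T.P base
  conn : ∀ u : bundle.total, bundle.total.T u →L[ℝ] T.G.lie
  contMDiff_conn : ContMDiff (M' := EuclideanSpace ℝ (Fin T.G.dim))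
    bundle.total.I.tangent 𝓘(ℝ, EuclideanSpace ℝ (Fin T.G.dim)) ∞
    (fun z : TangentBundle bundle.total.I bundle.total =>
      conn z.1 z.2)
  bijective_conn : ∀ u, Function.Bijective (conn u)
  conn_equivariant : ∀ (u : bundle.total) (p : T.P) (v : bundle.total.T u),
    conn (bundle.act u p)
      (mfderiv bundle.total.I bundle.total.I (fun u' => bundle.act u' p) u v) =
      T.G.Ad (T.ι p⁻¹) (conn u v)
  conn_fundamental : ∀ (u : bundle.total) (a : T.P.lie),
    conn (bundle.act u 1) (mfderiv T.P.I bundle.total.I (fun p : T.P => bundle.act u p) 1 a) =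
      lieMap T.ι a

namespace CartanGeometry

variable {T : ContactType.{v}} (X : CartanGeometry.{u, v} T)

/-- The constant vector field `ω⁻¹(A)`. -/
noncomputable def constField (A : T.G.lie) (u : X.bundle.total) : X.bundle.total.T u :=
  (LinearEquiv.ofBijective (X.conn u : X.bundle.total.T u →ₗ[ℝ] T.G.lie) (X.bijective_conn u)).symm A

/-- The curvature function, `κ(A, B) = K(ω⁻¹ A, ω⁻¹ B)` for `K(ξ, η) = dω(ξ, η) + [ω ξ, ω η]`. Since
`ω` is constant on constant vector fields, this is `[A, B] - ω([ω⁻¹ A, ω⁻¹ B])`. -/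
noncomputable def curvature (u : X.bundle.total) (A B : T.G.lie) : T.G.lie :=
  ⁅A, B⁆ - X.conn u (VectorField.mlieBracket X.bundle.total.I (X.constField A) (X.constField B) u)

/-- Regularity: the curvature is of positive homogeneity. -/
def IsRegular : Prop :=
  ∀ (u : X.bundle.total) (i j : ℤ), i < 0 → j < 0 → ∀ A ∈ T.grading.fil i, ∀ B ∈ T.grading.fil j,
    X.curvature u A B ∈ T.grading.fil (i + j + 1)

/-- Normality: `∂* κ = 0` for the Kostant codifferential `∂*`. For a basis `bᵢ` of `𝔤₋` with dual
basis `Zᵢ` of `𝔭₊` with respect to the Killing form, one has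
`(∂* φ)(A) = ∑ᵢ [Zᵢ, φ(A, bᵢ)] - ½ ∑ᵢ φ([Zᵢ, A], bᵢ)`. -/
def IsNormal : Prop :=
  ∀ (u : X.bundle.total) (n : ℕ) (b : Module.Basis (Fin n) ℝ T.grading.neg) (Z : Fin n → T.G.lie),
    (∀ i, Z i ∈ T.grading.fil 1) →
    (∀ i j, killingForm ℝ T.G.lie (Z i) (b j : T.G.lie) = if i = j then 1 else 0) →
    ∀ A ∈ T.grading.neg,
      ∑ i, ((2 : ℝ) • ⁅Z i, X.curvature u A (b i : T.G.lie)⁆ -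
        X.curvature u ⁅Z i, A⁆ (b i : T.G.lie)) = 0

end CartanGeometry

/-- A parabolic contact structure of type `(G, P)`, given by its canonical Cartan geometry, i.e. a
regular normal Cartan geometry of type `(G, P)`. -/
structure ParabolicContactStructure (T : ContactType.{v}) extends CartanGeometry.{u, v} T where
  regular : toCartanGeometry.IsRegular
  normal : toCartanGeometry.IsNormal

namespace ParabolicContactStructure

variable {T : ContactType.{v}}

/-- The sections of the natural bundle `𝒢 ×_P W`, where the representation `ρ` of `G₀` on `W` is
extended to `P = G₀ ⋉ P₊` by letting `P₊` act trivially: smooth functions that are equivariant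
for the action of the elements `g p` of `P`, with `g ∈ G₀` and `p ∈ P₊`. -/
def sections (X : ParabolicContactStructure.{u, v} T) {W : Type w} [NormedAddCommGroup W]
    [NormedSpace ℝ W] (ρ : SmoothRep T.G₀ W) : Submodule ℝ (X.bundle.total → W) where
  carrier := {f | ContMDiff X.bundle.total.I 𝓘(ℝ, W) ∞ f ∧
    ∀ u (g : T.G₀), ∀ p ∈ T.Pplus, f (X.bundle.act u (T.ι₀ g * p)) = ρ.toHom g⁻¹ (f u)}
  zero_mem' := ⟨contMDiff_const, fun _ _ _ _ => by simp⟩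
  add_mem' := fun {f f'} hf hf' =>
    ⟨hf.1.add hf'.1, fun u g p hp => by simp [hf.2 u g p hp, hf'.2 u g p hp]⟩
  smul_mem' := fun c f hf => ⟨(c • ContinuousLinearMap.id ℝ W).contMDiff.comp hf.1,
    fun u g p hp => by simp [hf.2 u g p hp]⟩

/-- `φ`, restricted to the preimage of the open subset `U` of the base of `X`, is an isomorphism
from the restriction of `X` to `U` onto the restriction of `Y` to an open subset: an injective
morphism of principal bundles that preserves the Cartan connections. (Since Cartan connections are
fiberwise isomorphisms, such a morphism is a diffeomorphism onto an open subset.) -/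
structure IsLocalIso (X Y : ParabolicContactStructure.{u, v} T) (U : Set X.base)
    (φ : X.bundle.total → Y.bundle.total) : Prop where
  isOpen : IsOpen U
  contMDiffOn : ContMDiffOn X.bundle.total.I Y.bundle.total.I ∞ φ (X.bundle.proj ⁻¹' U)
  equivariant : ∀ u ∈ X.bundle.proj ⁻¹' U, ∀ p : T.P,
    φ (X.bundle.act u p) = Y.bundle.act (φ u) p
  injOn : Set.InjOn φ (X.bundle.proj ⁻¹' U)
  pullback_conn : ∀ u ∈ X.bundle.proj ⁻¹' U, ∀ v : X.bundle.total.T u,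
    Y.conn (φ u) (mfderiv X.bundle.total.I Y.bundle.total.I φ u v) = X.conn u v

/-- An infinitesimal automorphism: a smooth vector field `ξ` on the base, with its `P`-invariant
lift to the Cartan bundle, whose local flows are automorphisms. -/
structure InfinitesimalAutomorphism (X : ParabolicContactStructure.{u, v} T) where
  ξ : ∀ x : X.base, X.base.T x
  contMDiff_ξ : ContMDiff X.base.I X.base.I.tangent ∞
    (fun x => (⟨x, ξ x⟩ : TangentBundle X.base.I X.base))
  lift : ∀ u : X.bundle.total, X.bundle.total.T u
  contMDiff_lift : ContMDiff X.bundle.total.I X.bundle.total.I.tangent ∞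
    (fun u => (⟨u, lift u⟩ : TangentBundle X.bundle.total.I X.bundle.total))
  mfderiv_proj_lift : ∀ u, mfderiv X.bundle.total.I X.base.I X.bundle.proj u (lift u) =
    ξ (X.bundle.proj u)
  lift_invariant : ∀ (u : X.bundle.total) (p : T.P),
    mfderiv X.bundle.total.I X.bundle.total.I (fun u' => X.bundle.act u' p) u (lift u) =
      lift (X.bundle.act u p)
  /-- Around each point, the local flow `Φ` of the lift (unique, and defined on the preimage of a
  neighborhood by invariance) consists of local automorphisms. -/
  flow : ∀ x : X.base, ∃ (U : Set X.base) (ε : ℝ) (Φ : ℝ → X.bundle.total → X.bundle.total),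
    IsOpen U ∧ x ∈ U ∧ 0 < ε ∧
    ContMDiffOn (𝓘(ℝ, ℝ).prod X.bundle.total.I) X.bundle.total.I ∞
      (fun z : ℝ × X.bundle.total => Φ z.1 z.2) (Set.Ioo (-ε) ε ×ˢ (X.bundle.proj ⁻¹' U)) ∧
    (∀ u ∈ X.bundle.proj ⁻¹' U, Φ 0 u = u ∧
      IsMIntegralCurveOn (fun t => Φ t u) lift (Set.Ioo (-ε) ε)) ∧
    ∀ t ∈ Set.Ioo (-ε) ε, IsLocalIso X X U (Φ t)

/-- The infinitesimal automorphism is transverse to the contact subbundle, which is the image of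
`{v | ω v ∈ 𝔤⁻¹}` in the tangent bundle of the base. -/
def InfinitesimalAutomorphism.IsTransverse {X : ParabolicContactStructure.{u, v} T}
    (ξ : X.InfinitesimalAutomorphism) : Prop :=
  ∀ (u : X.bundle.total) (v : X.bundle.total.T u), X.conn u v ∈ T.grading.fil (-1) →
    mfderiv X.bundle.total.I X.base.I X.bundle.proj u v ≠ ξ.ξ (X.bundle.proj u)

/-- The underlying principal `G₀`-bundle `𝒢₀ = 𝒢 / P₊` over the base: the quotient by `P₊` is given
by a surjective submersion `π` whose fibers are the `P₊`-orbits (this determines the manifold `𝒢₀`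
up to unique diffeomorphism). -/
structure UnderlyingBundle (X : ParabolicContactStructure.{u, v} T) where
  bundle : PrincipalBundle T.G₀ X.base
  π : X.bundle.total → bundle.total
  isSubmersion_π : Manifold.IsSubmersion X.bundle.total.I bundle.total.I ∞ π
  surjective_π : Function.Surjective π
  π_eq_iff : ∀ u u', π u = π u' ↔ ∃ p ∈ T.Pplus, u' = X.bundle.act u p
  proj_π : ∀ u, bundle.proj (π u) = X.bundle.proj u
  π_act : ∀ u (g : T.G₀), π (X.bundle.act u (T.ι₀ g)) = bundle.act (π u) g

end ParabolicContactStructure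

/-- An invariant linear differential operator between the natural bundles induced by two
representations of `G₀`: a linear differential operator on every manifold endowed with a parabolic
contact structure of type `(G, P)`, compatible with isomorphisms and with restriction to open
subsets, i.e. with isomorphisms between open subsets of such manifolds. -/
structure InvariantDiffOp {T : ContactType.{v}} {W : Type w} [NormedAddCommGroup W]
    [NormedSpace ℝ W] {W' : Type w'} [NormedAddCommGroup W'] [NormedSpace ℝ W']
    (ρ : SmoothRep T.G₀ W) (ρ' : SmoothRep T.G₀ W') where
  op : ∀ X : ParabolicContactStructure.{u, v} T, X.sections ρ →ₗ[ℝ] X.sections ρ'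
  isLinearDiffOp : ∀ X, IsLinearDiffOp (op X)
  invariant : ∀ (X Y : ParabolicContactStructure.{u, v} T) (U : Set X.base)
    (φ : X.bundle.total → Y.bundle.total), X.IsLocalIso Y U φ →
    ∀ (s : X.sections ρ) (t : Y.sections ρ),
      (∀ u ∈ X.bundle.proj ⁻¹' U, (s : X.bundle.total → W) u = (t : Y.bundle.total → W) (φ u)) →
      ∀ u ∈ X.bundle.proj ⁻¹' U,
        (op X s : X.bundle.total → W') u = (op Y t : Y.bundle.total → W') (φ u)

/-! ### PCS-structures and PCS-quotients -/

/-- A PCS-structure of type `(G, P)`: a principal `G₀`-bundle with a strictly horizontal,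
`G₀`-equivariant one-form `θ` with values in `𝔤₋₁` inducing isomorphisms of the tangent spaces of
the base with `𝔤₋₁`, such that the induced almost conformally symplectic structure is conformally
symplectic. If `𝔤` is of type `Cₙ`, one also prescribes a class of connections (making the base a
conformally Fedosov manifold). Neither the induced vector bundles nor the notion of a PCS-quotient
involve these connections, so they are not recorded here, which only makes results on
PCS-quotients more general. -/
structure PCSStructure (T : ContactType.{v}) where
  base : SmoothManifold.{u}
  bundle : PrincipalBundle T.G₀ base
  θ : ∀ u : bundle.total, bundle.total.T u →L[ℝ] T.G.lie
  contMDiff_θ : ContMDiff (M' := EuclideanSpace ℝ (Fin T.G.dim))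
    bundle.total.I.tangent 𝓘(ℝ, EuclideanSpace ℝ (Fin T.G.dim)) ∞
    (fun z : TangentBundle bundle.total.I bundle.total =>
      θ z.1 z.2)
  range_θ : ∀ (u : bundle.total) (A : T.G.lie), (∃ v, θ u v = A) ↔ A ∈ T.grading.gr (-1)
  θ_eq_zero_iff : ∀ (u : bundle.total) (v : bundle.total.T u),
    θ u v = 0 ↔ mfderiv bundle.total.I base.I bundle.proj u v = 0
  θ_equivariant : ∀ (u : bundle.total) (g : T.G₀) (v : bundle.total.T u),
    θ (bundle.act u g) (mfderiv bundle.total.I bundle.total.I (fun u' => bundle.act u' g) u v) =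
      T.G.Ad (T.ι (T.ι₀ g⁻¹)) (θ u v)
  /-- Locally (here in a chart), there is a closed two-form `τ` that spans the line of two-forms
  corresponding via `θ` to the bracket `𝔤₋₁ × 𝔤₋₁ → 𝔤₋₂`. -/
  conformallySymplectic : ∀ x : base, ∃ (V : Set (EuclideanSpace ℝ (Fin base.dim)))
    (τ : EuclideanSpace ℝ (Fin base.dim) → EuclideanSpace ℝ (Fin base.dim) [⋀^Fin 2]→L[ℝ] ℝ),
    IsOpen V ∧ V ⊆ (extChartAt base.I x).target ∧ extChartAt base.I x x ∈ V ∧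
    ContDiffOn ℝ ∞ τ V ∧ (∀ y ∈ V, extDeriv τ y = 0) ∧
    ∀ u : bundle.total, bundle.proj u ∈ (extChartAt base.I x).source →
      extChartAt base.I x (bundle.proj u) ∈ V →
      ∃ c : T.G.lie →ₗ[ℝ] ℝ, (∃ A ∈ T.grading.gr (-2), c A ≠ 0) ∧
        ∀ v v' : bundle.total.T u,
          τ (extChartAt base.I x (bundle.proj u))
            ![mfderiv bundle.total.I 𝓘(ℝ, EuclideanSpace ℝ (Fin base.dim))
                (fun u' => extChartAt base.I x (bundle.proj u')) u v,
              mfderiv bundle.total.I 𝓘(ℝ, EuclideanSpace ℝ (Fin base.dim))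
                (fun u' => extChartAt base.I x (bundle.proj u')) u v'] =
            c ⁅θ u v, θ u v'⁆

/-- A PCS-quotient `q : M♯ → M` of a parabolic contact structure `X` on `M♯` by a transverse
infinitesimal automorphism `ξ`, with PCS-structure `Y` on `M`. Here `upstairs` is the underlying
`G₀`-bundle of `X`, `ξ₀` the vector field on it induced by `ξ`, and `q₀` the lift of `q` to a morphism
of principal `G₀`-bundles. -/
structure PCSQuotient {T : ContactType.{v}} (X : ParabolicContactStructure.{u, v} T)
    (Y : PCSStructure.{u, v} T) where
  ξ : X.InfinitesimalAutomorphism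
  isTransverse_ξ : ξ.IsTransverse
  q : X.base → Y.base
  isSubmersion_q : Manifold.IsSubmersion X.base.I Y.base.I ∞ q
  surjective_q : Function.Surjective q
  isConnected_fiber_q : ∀ x, IsConnected (q ⁻¹' {x})
  ker_q : ∀ x, LinearMap.ker (mfderiv X.base.I Y.base.I q x).toLinearMap =
    Submodule.span ℝ {ξ.ξ x}
  upstairs : X.UnderlyingBundle
  ξ₀ : ∀ y : upstairs.bundle.total, upstairs.bundle.total.T y
  ξ₀_π : ∀ u, mfderiv X.bundle.total.I upstairs.bundle.total.I upstairs.π u (ξ.lift u) =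
    ξ₀ (upstairs.π u)
  q₀ : upstairs.bundle.total → Y.bundle.total
  proj_q₀ : ∀ y, Y.bundle.proj (q₀ y) = q (upstairs.bundle.proj y)
  q₀_act : ∀ y (g : T.G₀), q₀ (upstairs.bundle.act y g) = Y.bundle.act (q₀ y) g
  isSubmersion_q₀ : Manifold.IsSubmersion upstairs.bundle.total.I Y.bundle.total.I ∞ q₀
  surjective_q₀ : Function.Surjective q₀
  isConnected_fiber_q₀ : ∀ y, IsConnected (q₀ ⁻¹' {y})
  ker_q₀ : ∀ y, LinearMap.ker
      (mfderiv upstairs.bundle.total.I Y.bundle.total.I q₀ y).toLinearMap =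
    Submodule.span ℝ {ξ₀ y}
  /-- `q₀* θ` is the component in `𝔤₋₁` of the upstairs soldering form, the partially defined form
  induced by the `𝔤₋₁`-component of `ω` on `{v | ω v ∈ 𝔤⁻¹}`. -/
  pullback_θ : ∀ (u : X.bundle.total) (v : X.bundle.total.T u), X.conn u v ∈ T.grading.fil (-1) →
    X.conn u v - Y.θ (q₀ (upstairs.π u))
      (mfderiv upstairs.bundle.total.I Y.bundle.total.I q₀ (upstairs.π u)
        (mfderiv X.bundle.total.I upstairs.bundle.total.I upstairs.π u v)) ∈ T.grading.fil 0

/-- The map `q₀* : Γ(W M) → Γ(W M♯)`: pull back an equivariant function along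
`q₀ : 𝒢₀♯ → 𝒢₀`, and view the resulting function on `𝒢₀♯ = 𝒢♯ / P₊` as a function on `𝒢♯`. -/
def PCSQuotient.pullback {T : ContactType.{v}} {X : ParabolicContactStructure.{u, v} T}
    {Y : PCSStructure.{u, v} T} (Q : PCSQuotient X Y) {W : Type w} [NormedAddCommGroup W]
    [NormedSpace ℝ W] (ρ : SmoothRep T.G₀ W) : Y.bundle.sections ρ →ₗ[ℝ] X.sections ρ where
  toFun s := ⟨fun u => (s : Y.bundle.total → W) (Q.q₀ (Q.upstairs.π u)), by
    refine ⟨s.2.1.comp (Q.isSubmersion_q₀.contMDiff.comp Q.upstairs.isSubmersion_π.contMDiff), ?_⟩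
    · intro u g p hp
      have h : Q.upstairs.π (X.bundle.act u (T.ι₀ g * p)) =
          Q.upstairs.bundle.act (Q.upstairs.π u) g := by
        rw [← Q.upstairs.π_act, eq_comm, Q.upstairs.π_eq_iff]
        exact ⟨p, hp, X.bundle.act_mul _ _ _⟩
      change (s : Y.bundle.total → W) (Q.q₀ (Q.upstairs.π (X.bundle.act u (T.ι₀ g * p)))) = _
      rw [h, Q.q₀_act]
      exact s.2.2 _ _⟩
  map_add' _ _ := rfl
  map_smul' _ _ := rfl

end PCS

/-!
Put `p = q₀ ∘ π : 𝒢♯ → 𝒢₀♯ → 𝒢₀`. Identifying sections with equivariant functions, `q₀*` is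
composition with `p`, so it is injective because `p` is surjective. Hence `D` is unique and
automatically linear, and for its existence one has to see that `D♯ (q₀* s)` is always a pullback.

The pullback `q₀* s` is annihilated by the lift of `ξ`, as `ξ₀` spans the kernel of the derivative
of `q₀`, so it is preserved by the local flow of the lift. The flow consists of local automorphisms
of the parabolic contact structure, so `D♯ (q₀* s)` is preserved by it as well and is again
annihilated by the lift (`InvariantDiffOp.mfderiv_op_lift`). Being invariant under `P₊`, it descends
to a function on `𝒢₀♯`. The derivative of that function vanishes on the vertical bundle of `q₀`, and
since the fibers of `q₀` are connected, the function descends to `𝒢₀`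
(`PCSQuotient.exists_pullback_eq`). Smoothness of the descended functions and their local constancy
along fibers are read off from the local normal form `(a, b) ↦ a` of a submersion.

By the chain rule, the `r`-jet of `q₀* s` at `u` vanishes if that of `s` at `p u` does, so `D` is a
differential operator of the same order as `D♯`
(`PCSQuotient.isLinearDiffOp_of_pullback_comp`).
-/

namespace PCS

open Set Filter Topology

/-! ### Functions along submersions -/

lemma exists_normal_form_of_isSubmersion {M N : SmoothManifold.{u}} {p : M → N}
    (hp : Manifold.IsSubmersion M.I N.I ∞ p) (x : M) :
    ∃ (F : Type) (_ : NormedAddCommGroup F) (_ : NormedSpace ℝ F)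
      (φ : OpenPartialHomeomorph M (EuclideanSpace ℝ (Fin M.dim)))
      (ψ : OpenPartialHomeomorph N (EuclideanSpace ℝ (Fin N.dim)))
      (e : EuclideanSpace ℝ (Fin M.dim) ≃L[ℝ] EuclideanSpace ℝ (Fin N.dim) × F),
      x ∈ φ.source ∧ φ.source ⊆ p ⁻¹' ψ.source ∧ ContMDiffOn M.I M.I ∞ φ.symm φ.target ∧
        ContMDiffOn N.I N.I ∞ ψ ψ.source ∧ ∀ z ∈ φ.target, ψ (p (φ.symm z)) = (e z).1 := by
  obtain ⟨F, _, _, h⟩ := hp.isSubmersionAt x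
  obtain ⟨P⟩ := h
  obtain ⟨e, he⟩ := P.property
  refine ⟨F, inferInstance, inferInstance, P.domChart, P.codChart, e, P.mem_domChart_source,
    P.source_subset_preimage_source,
    contMDiffOn_symm_of_mem_maximalAtlas P.domChart_mem_maximalAtlas,
    contMDiffOn_of_mem_maximalAtlas P.codChart_mem_maximalAtlas, fun z hz => ?_⟩
  simpa using he (x := z) (by simpa using hz)

/-- A submersion has a smooth local section through every point of its source. -/
lemma exists_local_section_of_isSubmersion {M N : SmoothManifold.{u}} {p : M → N}
    (hp : Manifold.IsSubmersion M.I N.I ∞ p) (x : M) :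
    ∃ σ : N → M, ContMDiffAt N.I M.I ∞ σ (p x) ∧ ∀ᶠ y in 𝓝 (p x), p (σ y) = y := by
  obtain ⟨F, _, _, φ, ψ, e, hx, hφψ, hφ, hψ, hpe⟩ := exists_normal_form_of_isSubmersion hp x
  let k : EuclideanSpace ℝ (Fin N.dim) → EuclideanSpace ℝ (Fin M.dim) :=
    fun z => e.symm (z, (e (φ x)).2)
  have hk : ContDiff ℝ ∞ k := e.symm.contDiff.comp (contDiff_id.prodMk contDiff_const)
  have hkx : k (ψ (p x)) = φ x := by
    have := hpe (φ x) (φ.map_source hx)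
    rw [φ.left_inv hx] at this
    rw [ContinuousLinearEquiv.symm_apply_eq, this]
  have hkψ : ContMDiffAt N.I M.I ∞ (fun y => k (ψ y)) (p x) :=
    hk.contMDiff.contMDiffAt.comp (p x)
      (hψ.contMDiffAt (ψ.open_source.mem_nhds (hφψ hx)))
  have hmem : ∀ᶠ y in 𝓝 (p x), k (ψ y) ∈ φ.target := by
    refine hkψ.continuousAt.eventually_mem ?_
    rw [hkx]
    exact φ.open_target.mem_nhds (φ.map_source hx)
  refine ⟨fun y => φ.symm (k (ψ y)), ?_, ?_⟩
  · refine ContMDiffAt.comp (p x) (hφ.contMDiffAt ?_) hkψ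
    rw [hkx]
    exact φ.open_target.mem_nhds (φ.map_source hx)
  · filter_upwards [hmem, ψ.open_source.mem_nhds (hφψ hx)] with y hy hy'
    have h := hpe _ hy
    simp only [k, ContinuousLinearEquiv.apply_symm_apply] at h
    exact ψ.injOn (hφψ (φ.map_target hy)) hy' h

section Manifold

variable {W : Type w} [NormedAddCommGroup W] [NormedSpace ℝ W]

lemma contMDiff_of_comp_isSubmersion {M N : SmoothManifold.{u}} {p : M → N}
    (hp : Manifold.IsSubmersion M.I N.I ∞ p) (hsurj : Function.Surjective p) {f : N → W}
    (hf : ContMDiff M.I 𝓘(ℝ, W) ∞ (f ∘ p)) : ContMDiff N.I 𝓘(ℝ, W) ∞ f := by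
  intro y
  obtain ⟨x, rfl⟩ := hsurj y
  obtain ⟨σ, hσ, hpσ⟩ := exists_local_section_of_isSubmersion hp x
  refine (hf.contMDiffAt.comp (p x) hσ).congr_of_eventuallyEq ?_
  filter_upwards [hpσ] with y hy
  simp [hy]

/-- In the coordinates of a normal form `(a, b) ↦ a`, the points of a ball in one fiber are joined
by segments inside the fiber, and the derivative of `h` along these vanishes. -/
lemma eventually_eq_on_fiber_of_isSubmersion {M N : SmoothManifold.{u}} {p : M → N}
    (hp : Manifold.IsSubmersion M.I N.I ∞ p) {h : M → W} (hh : ContMDiff M.I 𝓘(ℝ, W) ∞ h)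
    (hker : ∀ (x : M) (v : M.T x), mfderiv M.I N.I p x v = 0 →
      mfderiv M.I 𝓘(ℝ, W) h x v = 0) (x : M) :
    ∀ᶠ x' in 𝓝 x, p x' = p x → h x' = h x := by
  obtain ⟨F, _, _, φ, ψ, e, hx, hφψ, hφ, hψ, hpe⟩ := exists_normal_form_of_isSubmersion hp x
  obtain ⟨r, hr, hball⟩ :=
    Metric.isOpen_iff.1 φ.open_target (φ x) (φ.map_source hx)
  have hnear : ∀ᶠ x' in 𝓝 x, φ x' ∈ Metric.ball (φ x) r :=
    (φ.continuousAt hx).eventually_mem (Metric.ball_mem_nhds _ hr)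
  filter_upwards [hnear, φ.open_source.mem_nhds hx] with x' hx'r hx' hpx
  let l : ℝ → EuclideanSpace ℝ (Fin M.dim) := AffineMap.lineMap (φ x) (φ x')
  have hl : ∀ t ∈ Icc (0 : ℝ) 1, l t ∈ φ.target := fun t ht => hball
    ((convex_ball (φ x) r).lineMap_mem (Metric.mem_ball_self hr) hx'r ht)
  have hfst : ∀ z ∈ φ.source, (e (φ z)).1 = ψ (p z) := fun z hz => by
    rw [← hpe _ (φ.map_source hz), φ.left_inv hz]
  have hconst : ∀ t, (e (l t)).1 = ψ (p x) := fun t => by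
    simp [l, AffineMap.lineMap_apply, hfst x hx, hfst x' hx', hpx]
  let U : Set ℝ := l ⁻¹' φ.target
  have hlc : ContDiff ℝ ∞ l := by
    simp only [l]
    fun_prop
  have hU : IsOpen U := φ.open_target.preimage hlc.continuous
  let c : ℝ → M := fun t => φ.symm (l t)
  have hc : ∀ t ∈ U, MDifferentiableAt 𝓘(ℝ, ℝ) M.I c t := fun t ht =>
    ((hφ.contMDiffAt (φ.open_target.mem_nhds ht)).comp t
      hlc.contMDiff.contMDiffAt).mdifferentiableAt (by simp)
  have hpc : ∀ t ∈ U, p (c t) = p x := fun t ht =>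
    ψ.injOn (hφψ (φ.map_target ht)) (hφψ hx) (by rw [hpe _ ht, hconst])
  have hderiv : ∀ t ∈ U, HasFDerivAt (h ∘ c) (0 : ℝ →L[ℝ] W) t := by
    intro t ht
    have hp0 : HasMFDerivAt 𝓘(ℝ, ℝ) N.I (p ∘ c) t
        ((mfderiv M.I N.I p (c t)).comp (mfderiv 𝓘(ℝ, ℝ) M.I c t)) :=
      HasMFDerivAt.comp t
        (hp.contMDiff.contMDiffAt.mdifferentiableAt (by simp)).hasMFDerivAt (hc t ht).hasMFDerivAt
    have hp1 : HasMFDerivAt 𝓘(ℝ, ℝ) N.I (p ∘ c) t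
        (0 : TangentSpace 𝓘(ℝ, ℝ) t →L[ℝ] TangentSpace N.I (p (c t))) := by
      rw [hpc t ht]
      refine (hasMFDerivAt_const (p x) t).congr_of_eventuallyEq ?_
      filter_upwards [hU.mem_nhds ht] with s hs using hpc s hs
    have hv := DFunLike.congr_fun (hasMFDerivAt_unique hp0 hp1) (1 : ℝ)
    have hh0 : HasMFDerivAt 𝓘(ℝ, ℝ) 𝓘(ℝ, W) (h ∘ c) t
        ((mfderiv M.I 𝓘(ℝ, W) h (c t)).comp (mfderiv 𝓘(ℝ, ℝ) M.I c t)) :=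
      HasMFDerivAt.comp t
        (hh.contMDiffAt.mdifferentiableAt (by simp)).hasMFDerivAt (hc t ht).hasMFDerivAt
    refine hh0.hasFDerivAt.congr_fderiv ?_
    refine ContinuousLinearMap.ext_ring ?_
    exact hker _ _ hv
  have key := (convex_Icc (0 : ℝ) 1).is_const_of_fderivWithin_eq_zero (𝕜 := ℝ) (f := h ∘ c)
    (fun t ht => (hderiv t (hl t ht)).differentiableAt.differentiableWithinAt)
    (fun t ht => (hderiv t (hl t ht)).hasFDerivWithinAt.fderivWithin
      ((uniqueDiffOn_Icc zero_lt_one) t ht))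
    (right_mem_Icc.2 zero_le_one) (left_mem_Icc.2 zero_le_one)
  simpa [c, l, φ.left_inv hx, φ.left_inv hx'] using key

lemma eq_of_isSubmersion_of_mfderiv_eq_zero {M N : SmoothManifold.{u}} {p : M → N}
    (hp : Manifold.IsSubmersion M.I N.I ∞ p) (hfib : ∀ y, IsPreconnected (p ⁻¹' {y}))
    {h : M → W} (hh : ContMDiff M.I 𝓘(ℝ, W) ∞ h)
    (hker : ∀ (x : M) (v : M.T x), mfderiv M.I N.I p x v = 0 →
      mfderiv M.I 𝓘(ℝ, W) h x v = 0) {x x' : M} (hxx' : p x = p x') : h x = h x' := by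
  have : PreconnectedSpace (p ⁻¹' {p x'}) := isPreconnected_iff_preconnectedSpace.1 (hfib _)
  have hloc : IsLocallyConstant (fun z : p ⁻¹' {p x'} => h z) := by
    refine (IsLocallyConstant.iff_eventually_eq _).2 fun z => ?_
    have := continuous_subtype_val.continuousAt.eventually
      (eventually_eq_on_fiber_of_isSubmersion hp hh hker z.1)
    filter_upwards [this] with z' hz'
    exact hz' (z'.2.trans z.2.symm)
  exact hloc.apply_eq_of_preconnectedSpace ⟨x, hxx'⟩ ⟨x', rfl⟩

/-! ### Jets under smooth maps -/

/-- The case `C = 0` of the bound `n! * C * D ^ n` for the derivatives of a composition, which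
replaces an explicit use of the Faà di Bruno formula. -/
lemma iteratedFDerivWithin_comp_eq_zero {E F : Type*} [NormedAddCommGroup E] [NormedSpace ℝ E]
    [NormedAddCommGroup F] [NormedSpace ℝ F] {g : F → W} {f : E → F} {s : Set E} {t : Set F}
    {x : E} (hg : ContDiffOn ℝ ∞ g t) (hf : ContDiffOn ℝ ∞ f s) (ht : UniqueDiffOn ℝ t)
    (hs : UniqueDiffOn ℝ s) (hst : MapsTo f s t) (hx : x ∈ s) {n : ℕ}
    (h : ∀ j ≤ n, iteratedFDerivWithin ℝ j g t (f x) = 0) :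
    iteratedFDerivWithin ℝ n (g ∘ f) s x = 0 := by
  let D : ℝ := 1 + ∑ i ∈ Finset.range (n + 1), ‖iteratedFDerivWithin ℝ i f s x‖
  have hD : 1 ≤ D := le_add_of_nonneg_right (by positivity)
  have := norm_iteratedFDerivWithin_comp_le (C := 0) (D := D) hg hf (n := n)
    (mod_cast le_top) ht hs hst hx
    (fun i hi => by simp [h i hi]) (fun i hi hin => by
      refine le_trans ?_ (le_self_pow₀ hD (by omega))
      refine le_add_of_nonneg_of_le zero_le_one
        (Finset.single_le_sum (f := fun i => ‖iteratedFDerivWithin ℝ i f s x‖)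
          (fun _ _ => norm_nonneg _) (Finset.mem_range.2 (by omega))))
  simpa using this

lemma iteratedFDeriv_comp_chart_eq_zero {M N : SmoothManifold.{u}} {p : M → N}
    (hp : ContMDiff M.I N.I ∞ p) {f : N → W} (hf : ContMDiff N.I 𝓘(ℝ, W) ∞ f) (x : M) {n : ℕ}
    (h : ∀ j ≤ n, iteratedFDeriv ℝ j (f ∘ (extChartAt N.I (p x)).symm)
      (extChartAt N.I (p x) (p x)) = 0) :
    iteratedFDeriv ℝ n ((f ∘ p) ∘ (extChartAt M.I x).symm) (extChartAt M.I x x) = 0 := by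
  have ht : IsOpen (extChartAt N.I (p x)).target := isOpen_extChartAt_target (p x)
  let s : Set (EuclideanSpace ℝ (Fin M.dim)) :=
    (extChartAt M.I x).target ∩ (extChartAt M.I x).symm ⁻¹' (p ⁻¹' (extChartAt N.I (p x)).source)
  have hs : IsOpen s :=
    (continuousOn_extChartAt_symm x).isOpen_inter_preimage (isOpen_extChartAt_target x)
      ((isOpen_extChartAt_source (p x)).preimage hp.continuous)
  have hx : extChartAt M.I x x ∈ s := by
    simp [s]
  have hg : ContDiffOn ℝ ∞ (f ∘ (extChartAt N.I (p x)).symm) (extChartAt N.I (p x)).target :=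
    (hf.comp_contMDiffOn (contMDiffOn_extChartAt_symm (p x))).contDiffOn
  have hk : ContDiffOn ℝ ∞ (extChartAt N.I (p x) ∘ p ∘ (extChartAt M.I x).symm) s := by
    refine ContMDiffOn.contDiffOn ?_
    refine (contMDiffOn_extChartAt (I := N.I) (x := p x) (n := ∞)).comp
      (hp.comp_contMDiffOn ((contMDiffOn_extChartAt_symm x).mono inter_subset_left)) ?_
    intro z hz
    simpa using hz.2
  have hmaps : MapsTo (extChartAt N.I (p x) ∘ p ∘ (extChartAt M.I x).symm) s
      (extChartAt N.I (p x)).target := fun z hz => (extChartAt N.I (p x)).map_source hz.2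
  have key := iteratedFDerivWithin_comp_eq_zero (n := n) hg hk ht.uniqueDiffOn hs.uniqueDiffOn
    hmaps hx (fun j hj => by
      rw [iteratedFDerivWithin_of_isOpen j ht (hmaps hx)]
      simpa using h j hj)
  rw [iteratedFDerivWithin_of_isOpen n hs hx] at key
  rw [← key]
  refine (Filter.EventuallyEq.iteratedFDeriv (𝕜 := ℝ) ?_ n).eq_of_nhds
  filter_upwards [hs.mem_nhds hx] with z hz
  exact congrArg f ((extChartAt N.I (p x)).left_inv hz.2).symm

end Manifold

section ParabolicContact

variable {T : ContactType.{v}} {W : Type w} [NormedAddCommGroup W] [NormedSpace ℝ W]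
  {W' : Type w'} [NormedAddCommGroup W'] [NormedSpace ℝ W']

/-! ### Invariant operators and infinitesimal automorphisms -/

lemma ContactType.one_mem_Pplus (T : ContactType.{v}) : (1 : T.P) ∈ T.Pplus := by
  refine ⟨0, by rw [map_zero]; exact zero_mem _, fun _ => 1, contMDiff_const, by simp, ?_, rfl⟩
  rw [mfderiv_const]
  rfl

/-- If `f` is annihilated by the lift of an infinitesimal automorphism, then it is invariant under
the local flow of the lift. This flow consists of local automorphisms, so invariance of the operator
shows that `D f` is constant along the flow lines, too. -/
lemma InvariantDiffOp.mfderiv_op_lift {ρ : SmoothRep T.G₀ W} {ρ' : SmoothRep T.G₀ W'}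
    (D : InvariantDiffOp.{u} ρ ρ') {X : ParabolicContactStructure.{u, v} T}
    (ξ : X.InfinitesimalAutomorphism) (f : X.sections ρ)
    (hf : ∀ u, mfderiv X.bundle.total.I 𝓘(ℝ, W) (f : X.bundle.total → W) u (ξ.lift u) = 0)
    (u : X.bundle.total) :
    mfderiv X.bundle.total.I 𝓘(ℝ, W') (D.op X f : X.bundle.total → W') u (ξ.lift u) = 0 := by
  obtain ⟨U, ε, Φ, -, hU, hε, -, hΦ, hiso⟩ := ξ.flow (X.bundle.proj u)
  have hcurve : ∀ u' ∈ X.bundle.proj ⁻¹' U, ∀ t ∈ Ioo (-ε) ε,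
      HasMFDerivAt 𝓘(ℝ, ℝ) X.bundle.total.I (fun t => Φ t u') t
        ((1 : ℝ →L[ℝ] ℝ).smulRight (ξ.lift (Φ t u'))) := fun u' hu' t ht =>
    ((hΦ u' hu').2 t ht).hasMFDerivAt (isOpen_Ioo.mem_nhds ht)
  have h0 : (0 : ℝ) ∈ Ioo (-ε) ε := ⟨by linarith, hε⟩
  have hinv : ∀ u' ∈ X.bundle.proj ⁻¹' U, ∀ t ∈ Ioo (-ε) ε,
      (f : X.bundle.total → W) u' = (f : X.bundle.total → W) (Φ t u') := by
    intro u' hu' t ht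
    have hderiv : ∀ t ∈ Ioo (-ε) ε,
        HasFDerivAt (fun t => (f : X.bundle.total → W) (Φ t u')) (0 : ℝ →L[ℝ] W) t := by
      intro t ht
      have := HasMFDerivAt.comp t
        ((f.2.1.contMDiffAt (x := Φ t u')).mdifferentiableAt (by simp)).hasMFDerivAt
        (hcurve u' hu' t ht)
      refine this.hasFDerivAt.congr_fderiv (ContinuousLinearMap.ext_ring ?_)
      change mfderiv X.bundle.total.I 𝓘(ℝ, W) (f : X.bundle.total → W) (Φ t u')
        ((1 : ℝ) • ξ.lift (Φ t u')) = 0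
      rw [one_smul]
      exact hf _
    have key := isOpen_Ioo.is_const_of_fderiv_eq_zero isPreconnected_Ioo
      (fun t ht => (hderiv t ht).differentiableAt.differentiableWithinAt)
      (fun t ht => (hderiv t ht).fderiv) h0 ht
    simpa [(hΦ u' hu').1] using key
  have hconst : ∀ t ∈ Ioo (-ε) ε, (D.op X f : X.bundle.total → W') u =
      (D.op X f : X.bundle.total → W') (Φ t u) := fun t ht =>
    D.invariant X X U (Φ t) (hiso t ht) f f (fun u' hu' => hinv u' hu' t ht) u hU
  have hd := HasMFDerivAt.comp 0
    (((D.op X f).2.1.contMDiffAt (x := Φ 0 u)).mdifferentiableAt (by simp)).hasMFDerivAt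
    (hcurve u hU 0 h0)
  have hc : HasFDerivAt ((D.op X f : X.bundle.total → W') ∘ fun t => Φ t u)
      (0 : ℝ →L[ℝ] W') 0 := by
    refine (hasFDerivAt_const ((D.op X f : X.bundle.total → W') u) (0 : ℝ)).congr_of_eventuallyEq ?_
    filter_upwards [isOpen_Ioo.mem_nhds h0] with t ht using (hconst t ht).symm
  have hd0 := hasMFDerivAt_unique hd hc.hasMFDerivAt
  have h1 : mfderiv X.bundle.total.I 𝓘(ℝ, W') (D.op X f : X.bundle.total → W') (Φ 0 u)
      ((1 : ℝ) • ξ.lift (Φ 0 u)) = 0 := DFunLike.congr_fun hd0 (1 : ℝ)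
  rwa [one_smul, (hΦ u hU).1] at h1

/-! ### Descent along a PCS-quotient -/

namespace PCSQuotient

variable {X : ParabolicContactStructure.{u, v} T} {Y : PCSStructure.{u, v} T}
  (Q : PCSQuotient X Y)

/-- The composition `𝒢♯ → 𝒢₀♯ → 𝒢₀` of the quotient map by `P₊` and `q₀`. -/
def toTotal (u : X.bundle.total) : Y.bundle.total :=
  Q.q₀ (Q.upstairs.π u)

lemma contMDiff_toTotal : ContMDiff X.bundle.total.I Y.bundle.total.I ∞ Q.toTotal :=
  Q.isSubmersion_q₀.contMDiff.comp Q.upstairs.isSubmersion_π.contMDiff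

lemma surjective_toTotal : Function.Surjective Q.toTotal :=
  Q.surjective_q₀.comp Q.upstairs.surjective_π

lemma toTotal_act (u : X.bundle.total) (g : T.G₀) :
    Q.toTotal (X.bundle.act u (T.ι₀ g)) = Y.bundle.act (Q.toTotal u) g := by
  rw [toTotal, Q.upstairs.π_act, Q.q₀_act, toTotal]

lemma pullback_apply (ρ : SmoothRep T.G₀ W) (s : Y.bundle.sections ρ) (u : X.bundle.total) :
    (Q.pullback ρ s : X.bundle.total → W) u = (s : Y.bundle.total → W) (Q.toTotal u) := rfl

lemma pullback_injective (ρ : SmoothRep T.G₀ W) : Function.Injective (Q.pullback ρ) := by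
  intro s s' h
  ext y
  obtain ⟨u, rfl⟩ := Q.surjective_toTotal y
  exact congrFun (congrArg Subtype.val h) u

lemma mfderiv_q₀_ξ₀ (y : Q.upstairs.bundle.total) :
    mfderiv Q.upstairs.bundle.total.I Y.bundle.total.I Q.q₀ y (Q.ξ₀ y) = 0 := by
  have h : Q.ξ₀ y ∈ Submodule.span ℝ {Q.ξ₀ y} := Submodule.mem_span_singleton_self _
  rw [← Q.ker_q₀ y] at h
  exact h

lemma mfderiv_comp_π_lift {f : Q.upstairs.bundle.total → W}
    (hf : ContMDiff Q.upstairs.bundle.total.I 𝓘(ℝ, W) ∞ f) (u : X.bundle.total) :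
    mfderiv X.bundle.total.I 𝓘(ℝ, W) (f ∘ Q.upstairs.π) u (Q.ξ.lift u) =
      mfderiv Q.upstairs.bundle.total.I 𝓘(ℝ, W) f (Q.upstairs.π u) (Q.ξ₀ (Q.upstairs.π u)) := by
  rw [mfderiv_comp u (hf.contMDiffAt.mdifferentiableAt (by simp))
    (Q.upstairs.isSubmersion_π.contMDiff.contMDiffAt.mdifferentiableAt (by simp)), ← Q.ξ₀_π]
  rfl

lemma mfderiv_pullback_lift (ρ : SmoothRep T.G₀ W) (s : Y.bundle.sections ρ)
    (u : X.bundle.total) :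
    mfderiv X.bundle.total.I 𝓘(ℝ, W) (Q.pullback ρ s : X.bundle.total → W) u (Q.ξ.lift u) = 0 := by
  have h := Q.mfderiv_comp_π_lift (s.2.1.comp Q.isSubmersion_q₀.contMDiff) u
  rw [mfderiv_comp _ (s.2.1.contMDiffAt.mdifferentiableAt (by simp))
    (Q.isSubmersion_q₀.contMDiff.contMDiffAt.mdifferentiableAt (by simp))] at h
  refine h.trans ?_
  exact (congrArg (mfderiv Y.bundle.total.I 𝓘(ℝ, W) (s : Y.bundle.total → W)
    (Q.q₀ (Q.upstairs.π u))) (Q.mfderiv_q₀_ξ₀ _)).trans (map_zero _)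

/-- Equivariance makes a section constant on the fibers of `𝒢♯ → 𝒢₀♯`, and the function that it
induces on `𝒢₀♯` is constant on the connected fibers of `q₀`, whose tangent
spaces are spanned by `ξ₀`. -/
lemma exists_pullback_eq (ρ : SmoothRep T.G₀ W) (f : X.sections ρ)
    (hf : ∀ u, mfderiv X.bundle.total.I 𝓘(ℝ, W) (f : X.bundle.total → W) u (Q.ξ.lift u) = 0) :
    ∃ s : Y.bundle.sections ρ, Q.pullback ρ s = f := by
  have hπ : ∀ u u', Q.upstairs.π u = Q.upstairs.π u' →
      (f : X.bundle.total → W) u = (f : X.bundle.total → W) u' := by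
    intro u u' h
    obtain ⟨p, hp, rfl⟩ := (Q.upstairs.π_eq_iff u u').1 h
    simpa using (f.2.2 u 1 p hp).symm
  obtain ⟨f₀, hf₀⟩ : ∃ f₀ : Q.upstairs.bundle.total → W, f₀ ∘ Q.upstairs.π = f :=
    ⟨fun y => (f : X.bundle.total → W) (Function.surjInv Q.upstairs.surjective_π y),
      funext fun u => hπ _ _ (Function.surjInv_eq _ _)⟩
  have hf₀s : ContMDiff Q.upstairs.bundle.total.I 𝓘(ℝ, W) ∞ f₀ :=
    contMDiff_of_comp_isSubmersion Q.upstairs.isSubmersion_π Q.upstairs.surjective_π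
      (hf₀ ▸ f.2.1)
  have hf₀ξ : ∀ y, mfderiv Q.upstairs.bundle.total.I 𝓘(ℝ, W) f₀ y (Q.ξ₀ y) = 0 := by
    intro y
    obtain ⟨u, rfl⟩ := Q.upstairs.surjective_π y
    have := Q.mfderiv_comp_π_lift hf₀s u
    rw [hf₀] at this
    exact this.symm.trans (hf u)
  have hq₀ : ∀ y y', Q.q₀ y = Q.q₀ y' → f₀ y = f₀ y' := by
    intro y y' h
    refine eq_of_isSubmersion_of_mfderiv_eq_zero Q.isSubmersion_q₀
      (fun z => (Q.isConnected_fiber_q₀ z).isPreconnected) hf₀s (fun x v hv => ?_) h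
    have hv' : v ∈ Submodule.span ℝ {Q.ξ₀ x} := by
      rw [← Q.ker_q₀ x]
      exact hv
    obtain ⟨c, rfl⟩ := Submodule.mem_span_singleton.1 hv'
    exact (map_smul (mfderiv Q.upstairs.bundle.total.I 𝓘(ℝ, W) f₀ x) c (Q.ξ₀ x)).trans
      ((congrArg (c • ·) (hf₀ξ x)).trans (smul_zero c))
  obtain ⟨s, hs⟩ : ∃ s : Y.bundle.total → W, s ∘ Q.q₀ = f₀ :=
    ⟨fun y => f₀ (Function.surjInv Q.surjective_q₀ y),
      funext fun y => hq₀ _ _ (Function.surjInv_eq _ _)⟩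
  have hsf : ∀ u, s (Q.toTotal u) = (f : X.bundle.total → W) u := fun u => by
    rw [← hf₀, ← hs]
    rfl
  refine ⟨⟨s, contMDiff_of_comp_isSubmersion Q.isSubmersion_q₀ Q.surjective_q₀ (hs ▸ hf₀s), ?_⟩,
    Subtype.ext (funext hsf)⟩
  intro y g
  obtain ⟨u, rfl⟩ := Q.surjective_toTotal y
  rw [← Q.toTotal_act, hsf, hsf]
  simpa using f.2.2 u g 1 T.one_mem_Pplus

/-- An operator that is `q₀`-related to a differential operator is a differential operator of the
same order, since the jet of `q₀* s` at a point is determined by the jet of `s` at its image. -/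
lemma isLinearDiffOp_of_pullback_comp {ρ : SmoothRep T.G₀ W} {ρ' : SmoothRep T.G₀ W'}
    {D' : X.sections ρ →ₗ[ℝ] X.sections ρ'} (hD' : IsLinearDiffOp D')
    {D : Y.bundle.sections ρ →ₗ[ℝ] Y.bundle.sections ρ'}
    (hD : Q.pullback ρ' ∘ₗ D = D' ∘ₗ Q.pullback ρ) : IsLinearDiffOp D := by
  obtain ⟨r, hr⟩ := hD'
  refine ⟨r, fun s y hs => ?_⟩
  obtain ⟨u, rfl⟩ := Q.surjective_toTotal y
  have h := hr (Q.pullback ρ s) u fun j hj =>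
    iteratedFDeriv_comp_chart_eq_zero Q.contMDiff_toTotal s.2.1 u
      fun i hi => hs i (hi.trans hj)
  have hs' : Q.pullback ρ' (D s) = D' (Q.pullback ρ s) := LinearMap.congr_fun hD s
  rwa [← hs'] at h

end PCSQuotient

end ParabolicContact

end PCS

theorem theorem2p4 {T : PCS.ContactType.{v}}
    {X : PCS.ParabolicContactStructure.{u, v} T} {Y : PCS.PCSStructure.{u, v} T}
    (Q : PCS.PCSQuotient X Y)
    {W : Type w} [NormedAddCommGroup W] [NormedSpace ℝ W] [FiniteDimensional ℝ W]
    {W' : Type w'} [NormedAddCommGroup W'] [NormedSpace ℝ W'] [FiniteDimensional ℝ W']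
    (ρ : PCS.SmoothRep T.G₀ W) (ρ' : PCS.SmoothRep T.G₀ W')
    (Dsharp : PCS.InvariantDiffOp.{u} ρ ρ') :
    ∃! D : Y.bundle.sections ρ →ₗ[ℝ] Y.bundle.sections ρ',
      PCS.IsLinearDiffOp D ∧
        Q.pullback ρ' ∘ₗ D = Dsharp.op X ∘ₗ Q.pullback ρ := by
  have hinj := Q.pullback_injective ρ'
  have hex : ∀ s : Y.bundle.sections ρ, ∃ t : Y.bundle.sections ρ',
      Q.pullback ρ' t = Dsharp.op X (Q.pullback ρ s) := fun s =>
    Q.exists_pullback_eq ρ' _ (Dsharp.mfderiv_op_lift Q.ξ _ (Q.mfderiv_pullback_lift ρ s))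
  choose d hd using hex
  let D : Y.bundle.sections ρ →ₗ[ℝ] Y.bundle.sections ρ' :=
    { toFun := d
      map_add' := fun s t => hinj (by simp only [hd, map_add])
      map_smul' := fun c s => hinj (by simp only [hd, map_smul, RingHom.id_apply]) }
  have hD : Q.pullback ρ' ∘ₗ D = Dsharp.op X ∘ₗ Q.pullback ρ := LinearMap.ext hd
  refine ⟨D, ⟨Q.isLinearDiffOp_of_pullback_comp (Dsharp.isLinearDiffOp X) hD, hD⟩, ?_⟩
  rintro D' ⟨-, hD'⟩
  refine LinearMap.ext fun s => hinj ?_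
  exact (LinearMap.congr_fun hD' s).trans (LinearMap.congr_fun hD s).symm
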